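/- **Theorem 1.2.** A polynomial $f\in\mathbb C[z_1,\ldots,z_n]$ is called *stable* if $f(z_1,\ldots,z_n)\neq 0$ for all $(z_1,\ldots,z_n)\in\mathbb C^n$ with $\operatorname{Im}(z_j)>0$ for $1\le j\le n$. Let $\mathcal H_n(\mathbb C)$ be the set of stable polynomials in $n$ variables. Let $\mathcal A_n[\mathbb C]$ be the Weyl algebra of finite order linear differential operators with polynomial coefficients on $\mathbb C[z_1,\ldots,z_n]$. Every $T\in\mathcal A_n[\mathbb C]$ has a unique representation $$T=\sum_{\alpha,\beta\in\mathbb N^n}a_{\alpha\beta}\,z^\alpha\partial^\beta,\qquad a_{\alpha\beta}\in\mathbb C,$$ with only finitely many nonzero $a_{\alpha\beta}$, where $z^\alpha=z_1^{\alpha_1}\cdots z_n^{\alpha_n}$, $\partial^\beta=\partial_1^{\beta_1}\cdots\partial_n^{\beta_n}$ and $\partial_i=\partial/\partial z_i$. Its *symbol* is the polynomial $F_T(z,w)=\sum_{\alpha,\beta}a_{\alpha\beta}\,z^\alpha w^\beta$ in the $2n$ variables $z_1,\ldots,z_n,w_1,\ldots,w_n$. Call $T$ *stability preserving* if $T\neq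 0$ and $T(f)\in\mathcal H_n(\mathbb C)\cup\{0\}$ for every $f\in\mathcal H_n(\mathbb C)$. Then for every $T\in\mathcal A_n[\mathbb C]$, $$T\text{ is stability preserving}\iff F_T(z,-w)\in\mathcal H_{2n}(\mathbb C).$$ -/

import Mathlib

open MvPolynomial

/-- A polynomial `f ∈ ℂ[z_s : s ∈ σ]` is stable if `f(z) ≠ 0` whenever `Im z_s > 0` for all `s`. -/
def IsStable {σ : Type*} (f : MvPolynomial σ ℂ) : Prop :=
  ∀ z : σ → ℂ, (∀ s, 0 < (z s).im) → eval z f ≠ 0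

/-- The set `H(ℂ)` of stable polynomials in the variables `σ`. -/
def stablePolynomials (σ : Type*) : Set (MvPolynomial σ ℂ) := {f | IsStable f}

/-- The operator "multiplication by `z_i`" on `ℂ[z_1, …, z_n]`. -/
noncomputable def mulVar {n : ℕ} (i : Fin n) : Module.End ℂ (MvPolynomial (Fin n) ℂ) :=
  LinearMap.mulLeft ℂ (X i)

/-- The operator `∂_i = ∂/∂z_i` on `ℂ[z_1, …, z_n]`. -/
noncomputable def partialDeriv {n : ℕ} (i : Fin n) : Module.End ℂ (MvPolynomial (Fin n) ℂ) :=
  (pderiv i : Derivation ℂ (MvPolynomial (Fin n) ℂ) (MvPolynomial (Fin n) ℂ)).toLinearMap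

/-- The Weyl algebra `A_n[ℂ]`: the algebra of operators on `ℂ[z_1, …, z_n]` generated by the
multiplications by the variables and the partial derivatives. -/
noncomputable def weylAlgebra (n : ℕ) : Subalgebra ℂ (Module.End ℂ (MvPolynomial (Fin n) ℂ)) :=
  Algebra.adjoin ℂ (Set.range mulVar ∪ Set.range partialDeriv)

/-- The operator `z^α = z_1^{α_1} ⋯ z_n^{α_n}` (a composition of multiplications). -/
noncomputable def mulPow {n : ℕ} (α : Fin n →₀ ℕ) : Module.End ℂ (MvPolynomial (Fin n) ℂ) :=
  ((List.finRange n).map fun i => mulVar i ^ α i).prod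

/-- The operator `∂^β = ∂_1^{β_1} ⋯ ∂_n^{β_n}`. -/
noncomputable def partialPow {n : ℕ} (β : Fin n →₀ ℕ) : Module.End ℂ (MvPolynomial (Fin n) ℂ) :=
  ((List.finRange n).map fun i => partialDeriv i ^ β i).prod

/-- The differential operator `∑ a_{αβ} z^α ∂^β` with finitely many nonzero coefficients. -/
noncomputable def diffOp {n : ℕ} (a : (Fin n →₀ ℕ) × (Fin n →₀ ℕ) →₀ ℂ) :
    Module.End ℂ (MvPolynomial (Fin n) ℂ) :=
  a.sum fun p c => c • (mulPow p.1 * partialPow p.2)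

theorem mulPow_apply {n : ℕ} (α : Fin n →₀ ℕ) (f : MvPolynomial (Fin n) ℂ) :
    mulPow α f = monomial α 1 * f := by
  have h1 : ∀ (i : Fin n) (k : ℕ) (g : MvPolynomial (Fin n) ℂ),
      (mulVar i ^ k) g = X i ^ k * g := by
    intro i k g
    rw [mulVar, LinearMap.pow_mulLeft, LinearMap.mulLeft_apply]
  have h : ∀ l : List (Fin n), (l.map fun i => mulVar i ^ α i).prod f =
      (l.map fun i => (X i : MvPolynomial (Fin n) ℂ) ^ α i).prod * f := by
    intro l
    induction l with
    | nil => simp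
    | cons i l ih => simp [Module.End.mul_apply, ih, h1, mul_assoc]
  rw [mulPow, h, monomial_eq, Finsupp.prod_fintype _ _ (by simp)]
  simp [← List.ofFn_eq_map, List.prod_ofFn]

theorem partialDeriv_pow_monomial {n : ℕ} (i : Fin n) (k : ℕ) (γ : Fin n →₀ ℕ) (c : ℂ) :
    (partialDeriv i ^ k) (monomial γ c) =
      monomial (γ - Finsupp.single i k) (c * ((γ i).descFactorial k : ℂ)) := by
  induction k with
  | zero => simp
  | succ k ih =>
    rw [pow_succ', Module.End.mul_apply, ih]
    change pderiv i _ = _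
    rw [pderiv_monomial, tsub_tsub, ← Finsupp.single_add]
    congr 1
    simp [Nat.descFactorial_succ]
    ring

theorem partialPow_monomial {n : ℕ} (β γ : Fin n →₀ ℕ) (c : ℂ) :
    partialPow β (monomial γ c) =
      monomial (γ - β) (c * ∏ i, ((γ i).descFactorial (β i) : ℂ)) := by
  have h : ∀ l : List (Fin n), l.Nodup → (l.map fun i => partialDeriv i ^ β i).prod (monomial γ c) =
      monomial (γ - (l.map fun i => Finsupp.single i (β i)).sum)
        (c * (l.map fun i => ((γ i).descFactorial (β i) : ℂ)).prod) := by
    intro l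
    induction l with
    | nil => simp
    | cons i l ih =>
      intro hl
      rw [List.nodup_cons] at hl
      have h0 : ((l.map fun j => Finsupp.single j (β j)).sum : Fin n →₀ ℕ) i = 0 := by
        have : ∀ l : List (Fin n), i ∉ l →
            ((l.map fun j => Finsupp.single j (β j)).sum : Fin n →₀ ℕ) i = 0 := by
          intro l
          induction l with
          | nil => simp
          | cons j l ih =>
            intro h
            simp only [List.mem_cons, not_or] at h
            simp [ih h.2, Finsupp.single_eq_of_ne h.1]
        exact this l hl.1
      simp only [List.map_cons, List.prod_cons, List.sum_cons, Module.End.mul_apply, ih hl.2,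
        partialDeriv_pow_monomial]
      rw [tsub_tsub, add_comm]
      congr 1
      rw [Finsupp.tsub_apply, h0, tsub_zero]
      ring
  rw [partialPow, h _ (List.nodup_finRange n)]
  congr 2
  rw [← List.ofFn_eq_map, List.sum_ofFn, Finsupp.univ_sum_single]

/-- `a ↦ ∑ a_{αβ} z^α ∂^β` as a linear map. -/
noncomputable def diffOpLinear (n : ℕ) :
    ((Fin n →₀ ℕ) × (Fin n →₀ ℕ) →₀ ℂ) →ₗ[ℂ] Module.End ℂ (MvPolynomial (Fin n) ℂ) :=
  Finsupp.linearCombination ℂ fun p => mulPow p.1 * partialPow p.2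

theorem diffOpLinear_apply {n : ℕ} (a : (Fin n →₀ ℕ) × (Fin n →₀ ℕ) →₀ ℂ) :
    diffOpLinear n a = diffOp a := rfl

theorem diffOpLinear_injective (n : ℕ) : Function.Injective (diffOpLinear n) := by
  rw [injective_iff_map_eq_zero]
  intro a ha
  by_contra hne
  obtain ⟨p, hp, hmin⟩ := Finset.exists_min_image a.support (fun p => p.2.degree)
    (Finsupp.support_nonempty_iff.mpr hne)
  have h1 := congrArg (fun T => coeff p.1 (T (monomial p.2 1))) ha
  simp only [diffOpLinear_apply, diffOp, Finsupp.sum, LinearMap.sum_apply, LinearMap.smul_apply,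
    Module.End.mul_apply, mulPow_apply, partialPow_monomial, coeff_sum, coeff_smul,
    LinearMap.zero_apply, coeff_zero, monomial_mul, one_mul, coeff_monomial, smul_eq_mul] at h1
  rw [Finset.sum_eq_single p] at h1
  · simp only [tsub_self, add_zero, if_true, Nat.descFactorial_self] at h1
    rcases mul_eq_zero.mp h1 with h | h
    · exact (Finsupp.mem_support_iff.mp hp) h
    · exact Finset.prod_ne_zero_iff.mpr
        (fun i _ => Nat.cast_ne_zero.mpr (Nat.factorial_ne_zero _)) h
  · intro q hq hqp
    by_cases hle : q.2 ≤ p.2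
    · have hqe : q.2 = p.2 := by
        have hd := hmin q hq
        have hs : p.2 = (p.2 - q.2) + q.2 := (tsub_add_cancel_of_le hle).symm
        have : (p.2 - q.2).degree = 0 := by
          have := congrArg Finsupp.degree hs
          rw [map_add] at this
          omega
        rw [Finsupp.degree_eq_zero_iff] at this
        rw [this, zero_add] at hs
        exact hs.symm
      have hq1 : q.1 ≠ p.1 := fun h => hqp (Prod.ext h hqe)
      rw [if_neg, mul_zero]
      rw [hqe, tsub_self, add_zero]
      exact hq1
    · have : ∃ i, p.2 i < q.2 i := by
        by_contra hcon
        push Not at hcon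
        exact hle hcon
      obtain ⟨i, hi⟩ := this
      rw [Finset.prod_eq_zero (Finset.mem_univ i)
        (by rw [Nat.descFactorial_of_lt hi, Nat.cast_zero])]
      simp
  · intro h
    exact absurd hp h

theorem mulVar_mul_mulPow {n : ℕ} (i : Fin n) (α : Fin n →₀ ℕ) :
    mulVar i * mulPow α = mulPow (Finsupp.single i 1 + α) := by
  refine LinearMap.ext fun f => ?_
  simp [Module.End.mul_apply, mulPow_apply, mulVar, X, ← mul_assoc, monomial_mul]

theorem partialDeriv_mul_partialPow {n : ℕ} (i : Fin n) (β : Fin n →₀ ℕ) :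
    partialDeriv i * partialPow β = partialPow (β + Finsupp.single i 1) := by
  refine (basisMonomials (Fin n) ℂ).ext fun γ => ?_
  rw [coe_basisMonomials, Module.End.mul_apply, partialPow_monomial, partialPow_monomial]
  change pderiv i _ = _
  rw [pderiv_monomial, tsub_tsub]
  congr 1
  rw [one_mul, one_mul, ← Finset.mul_prod_erase _ _ (Finset.mem_univ i),
    ← Finset.mul_prod_erase _ _ (Finset.mem_univ i)]
  have : ∏ x ∈ Finset.univ.erase i, ((γ x).descFactorial ((β + Finsupp.single i 1 : Fin n →₀ ℕ) x) : ℂ) =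
      ∏ x ∈ Finset.univ.erase i, ((γ x).descFactorial (β x) : ℂ) := by
    refine Finset.prod_congr rfl fun x hx => ?_
    rw [Finsupp.add_apply, Finsupp.single_eq_of_ne (Finset.ne_of_mem_erase hx), add_zero]
  rw [this]
  simp [Nat.descFactorial_succ]
  ring

theorem partialDeriv_mul_mulPow {n : ℕ} (i : Fin n) (α : Fin n →₀ ℕ) :
    partialDeriv i * mulPow α =
      mulPow α * partialDeriv i + (α i : ℂ) • mulPow (α - Finsupp.single i 1) := by
  refine LinearMap.ext fun f => ?_
  simp only [Module.End.mul_apply, LinearMap.add_apply, LinearMap.smul_apply, mulPow_apply]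
  change pderiv i _ = _ * pderiv i f + _
  rw [Derivation.leibniz, pderiv_monomial, smul_eq_mul, smul_eq_mul, one_mul, mul_comm f,
    ← smul_mul_assoc, smul_monomial, smul_eq_mul, mul_one]

theorem mulPow_mem {n : ℕ} (α : Fin n →₀ ℕ) : mulPow α ∈ weylAlgebra n := by
  refine Subalgebra.list_prod_mem (weylAlgebra n) fun T hT => ?_
  obtain ⟨i, -, rfl⟩ := List.mem_map.mp hT
  exact (weylAlgebra n).pow_mem (Algebra.subset_adjoin (Or.inl ⟨i, rfl⟩)) _

theorem partialPow_mem {n : ℕ} (β : Fin n →₀ ℕ) : partialPow β ∈ weylAlgebra n := by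
  refine Subalgebra.list_prod_mem (weylAlgebra n) fun T hT => ?_
  obtain ⟨i, -, rfl⟩ := List.mem_map.mp hT
  exact (weylAlgebra n).pow_mem (Algebra.subset_adjoin (Or.inr ⟨i, rfl⟩)) _

theorem range_diffOpLinear (n : ℕ) :
    LinearMap.range (diffOpLinear n) = Subalgebra.toSubmodule (weylAlgebra n) := by
  have hspan : LinearMap.range (diffOpLinear n) = Submodule.span ℂ
      (Set.range fun p : (Fin n →₀ ℕ) × (Fin n →₀ ℕ) => mulPow p.1 * partialPow p.2) :=
    Finsupp.range_linearCombination ℂ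
  have hbase : ∀ α β : Fin n →₀ ℕ, mulPow α * partialPow β ∈ LinearMap.range (diffOpLinear n) := by
    intro α β
    rw [hspan]
    exact Submodule.subset_span ⟨(α, β), rfl⟩
  apply le_antisymm
  · rw [hspan, Submodule.span_le]
    rintro _ ⟨p, rfl⟩
    exact (weylAlgebra n).mul_mem (mulPow_mem p.1) (partialPow_mem p.2)
  · have hstep : ∀ S : Module.End ℂ (MvPolynomial (Fin n) ℂ),
        (∀ α β : Fin n →₀ ℕ, S * (mulPow α * partialPow β) ∈ LinearMap.range (diffOpLinear n)) →
        ∀ T ∈ LinearMap.range (diffOpLinear n), S * T ∈ LinearMap.range (diffOpLinear n) := by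
      intro S hS T hT
      nth_rewrite 1 [hspan] at hT
      induction hT using Submodule.span_induction with
      | mem x hx => obtain ⟨p, rfl⟩ := hx; exact hS p.1 p.2
      | zero => rw [mul_zero]; exact zero_mem _
      | add x y _ _ hx hy => rw [mul_add]; exact add_mem hx hy
      | smul c x _ hx => rw [mul_smul_comm]; exact Submodule.smul_mem _ c hx
    have hone : (1 : Module.End ℂ (MvPolynomial (Fin n) ℂ)) ∈ LinearMap.range (diffOpLinear n) := by
      have := hbase 0 0
      simpa [mulPow, partialPow] using this
    intro T hT
    have key : ∀ U ∈ LinearMap.range (diffOpLinear n), T * U ∈ LinearMap.range (diffOpLinear n) := by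
      change T ∈ Algebra.adjoin ℂ _ at hT
      induction hT using Algebra.adjoin_induction with
      | mem x hx =>
        rcases hx with ⟨i, rfl⟩ | ⟨i, rfl⟩
        · refine hstep _ fun α β => ?_
          rw [← mul_assoc, mulVar_mul_mulPow]
          exact hbase _ _
        · refine hstep _ fun α β => ?_
          rw [← mul_assoc, partialDeriv_mul_mulPow, add_mul, mul_assoc,
            partialDeriv_mul_partialPow, smul_mul_assoc]
          exact add_mem (hbase _ _) (Submodule.smul_mem _ _ (hbase _ _))
      | algebraMap r =>
        intro U hU
        rw [← Algebra.smul_def]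
        exact Submodule.smul_mem _ _ hU
      | add x y _ _ hx hy =>
        intro U hU
        rw [add_mul]
        exact add_mem (hx U hU) (hy U hU)
      | mul x y _ _ hx hy =>
        intro U hU
        rw [mul_assoc]
        exact hx _ (hy U hU)
    simpa using key 1 hone

/-- Every `T` in the Weyl algebra is `∑ a_{αβ} z^α ∂^β` for a unique finitely supported `a`. -/
theorem existsUnique_diffOp {n : ℕ} (T : weylAlgebra n) :
    ∃! a : (Fin n →₀ ℕ) × (Fin n →₀ ℕ) →₀ ℂ,
      (T : Module.End ℂ (MvPolynomial (Fin n) ℂ)) = diffOp a := by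
  have hT : (T : Module.End ℂ (MvPolynomial (Fin n) ℂ)) ∈ LinearMap.range (diffOpLinear n) := by
    rw [range_diffOpLinear]
    exact T.2
  obtain ⟨a, ha⟩ := hT
  refine ⟨a, ha.symm, fun b hb => diffOpLinear_injective n ?_⟩
  rw [ha, hb, diffOpLinear_apply]

/-- The coefficients `a_{αβ}` of `T = ∑ a_{αβ} z^α ∂^β`. -/
noncomputable def weylCoeffs {n : ℕ} (T : weylAlgebra n) :
    (Fin n →₀ ℕ) × (Fin n →₀ ℕ) →₀ ℂ :=
  (existsUnique_diffOp T).choose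

theorem diffOp_weylCoeffs {n : ℕ} (T : weylAlgebra n) :
    (T : Module.End ℂ (MvPolynomial (Fin n) ℂ)) = diffOp (weylCoeffs T) :=
  (existsUnique_diffOp T).choose_spec.1

/-- The symbol `F_T(z, w) = ∑ a_{αβ} z^α w^β` of `T`, a polynomial in the `2n` variables
`z_i = X (Sum.inl i)` and `w_i = X (Sum.inr i)`. -/
noncomputable def symbol {n : ℕ} (T : weylAlgebra n) : MvPolynomial (Fin n ⊕ Fin n) ℂ :=
  (weylCoeffs T).sum fun p c =>
    C c * ((∏ i, X (Sum.inl i) ^ p.1 i) * ∏ i, X (Sum.inr i) ^ p.2 i)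

/-- The substitution `F(z, w) ↦ F(z, -w)`. -/
noncomputable def negW {n : ℕ} (F : MvPolynomial (Fin n ⊕ Fin n) ℂ) :
    MvPolynomial (Fin n ⊕ Fin n) ℂ :=
  aeval (Sum.elim (fun i => X (Sum.inl i)) fun i => -X (Sum.inr i)) F

/-- The set `A_n(ℂ)` of stability preservers: the nonzero `T` in the Weyl algebra that map every
stable polynomial to a stable polynomial or to zero. -/
def stabilityPreservers (n : ℕ) : Set (weylAlgebra n) :=
  {T | T ≠ 0 ∧ ∀ f ∈ stablePolynomials (Fin n),
    (T : Module.End ℂ (MvPolynomial (Fin n) ℂ)) f ∈ stablePolynomials (Fin n) ∪ {0}}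

/-! Sufficiency. If `F(z,-w)` and `f` are stable, so is `F(z,-w) f(v)` in `3n` variables. Replacing
each `w_i` by `-∂/∂v_i` and then setting `v = z` turns this product into `T f`. One replacement is
`exp(-∂_w ∂_v)` followed by `w = 0`, and the exponential is the limit of `(1 - ∂_w ∂_v / N)^N`. Each
factor preserves stability because the logarithmic derivative of a stable univariate polynomial has
nonpositive imaginary part (`sub_derivative_eval_ne_zero`), and Hurwitz' theorem carries stability
to the limit, up to the zero polynomial (`IsStable.liebSokal_or_eq_zero`).

Necessity. The polynomials `∏ (1 - w_j z_j / N)^N` are stable in `z` for `w` in the upper half-plane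
and approximate `exp(-z·w)`, and `T exp(-z·w) = F(z,-w) exp(-z·w)`. After removal of nonvanishing
factors, `T` of these products tends to `F(z,-w)`, so Hurwitz applies again if the approximants are
zero-free for infinitely many `N`. Otherwise `T` annihilates such products for arbitrarily large
`N`. Any polynomial of degree at most `N` in each variable is dominated by such a product on the
half-planes, so a small multiple of it can be added without losing stability; hence every value of
`T` is stable or zero. A linear space of that kind is at most a line, and a nonzero differential
operator in at least one variable cannot have its range in a line (`eq_zero_of_range_le_span`). -/

/-! ### Hurwitz' theorem. -/

open Filter Topology in
/-- One-variable Hurwitz theorem for a continuous family of entire functions. -/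
theorem eventually_eq_zero_of_frequently_ne_zero {φ : ℝ → ℂ → ℂ}
    (hc : Continuous (Function.uncurry φ)) (hd : ∀ ε, Differentiable ℂ (φ ε)) {r : ℝ} (hr : 0 < r)
    (hne : ∃ᶠ ε in 𝓝 (0 : ℝ), ∀ t ∈ Metric.ball (0 : ℂ) r, φ ε t ≠ 0) (h0 : φ 0 0 = 0) :
    ∀ᶠ t in 𝓝 (0 : ℂ), φ 0 t = 0 := by
  rcases ((hd 0).analyticAt 0).eventually_eq_zero_or_eventually_ne_zero with h | h
  · exact h
  exfalso
  obtain ⟨δ, hδ, hδ'⟩ := Metric.eventually_nhds_iff_ball.mp (eventually_nhdsWithin_iff.mp h)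
  -- On the circle of radius `ρ` the limit has no zeros, and the closed disc lies where the
  -- approximants are zero-free.
  set ρ := min (δ / 2) (r / 2) with hρ
  have hρ0 : 0 < ρ := by positivity
  have hρδ : ρ < δ := (min_le_left _ _).trans_lt (by linarith)
  have hρr : ρ < r := (min_le_right _ _).trans_lt (by linarith)
  have hsub : Metric.closedBall (0 : ℂ) ρ ⊆ Metric.ball 0 r := Metric.closedBall_subset_ball hρr
  obtain ⟨t₀, ht₀, hmin⟩ := (isCompact_sphere (0 : ℂ) ρ).exists_isMinOn
    (NormedSpace.sphere_nonempty.mpr hρ0.le) (hd 0).continuous.norm.continuousOn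
  have ht₀' : φ 0 t₀ ≠ 0 := by
    apply hδ' t₀
    · rw [mem_ball_zero_iff, mem_sphere_zero_iff_norm.mp ht₀]; exact hρδ
    · rintro rfl
      rw [mem_sphere_zero_iff_norm, norm_zero] at ht₀
      exact hρ0.ne ht₀
  set m := ‖φ 0 t₀‖ with hm
  have hm0 : 0 < m := norm_pos_iff.mpr ht₀'
  have hsph : ∀ᶠ ε in 𝓝 (0 : ℝ), ∀ t ∈ Metric.sphere (0 : ℂ) ρ, m / 2 < ‖φ ε t‖ := by
    refine (isCompact_sphere (0 : ℂ) ρ).eventually_forall_of_forall_eventually fun t ht => ?_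
    refine (hc.norm.continuousAt (x := ((0 : ℝ), t))).eventually_const_lt ?_
    exact lt_of_lt_of_le (by linarith) (hmin ht)
  have hcen : ∀ᶠ ε in 𝓝 (0 : ℝ), ‖φ ε 0‖ < m / 2 := by
    have : Continuous fun ε => ‖φ ε 0‖ :=
      (hc.comp (by fun_prop : Continuous fun ε : ℝ => (ε, (0 : ℂ)))).norm
    refine this.continuousAt.eventually_lt_const ?_
    simp only [h0, norm_zero]; positivity
  obtain ⟨ε, hε, hε1, hε2⟩ := (hne.and_eventually (hsph.and hcen)).exists
  -- The maximum principle for the reciprocal contradicts a modulus above `m / 2` on the circle and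
  -- below it at the centre.
  have hdc : DiffContOnCl ℂ (fun t => (φ ε t)⁻¹) (Metric.ball 0 ρ) := by
    refine DifferentiableOn.diffContOnCl fun t ht => ?_
    rw [closure_ball _ hρ0.ne'] at ht
    exact ((hd ε).differentiableAt.inv (hε t (hsub ht))).differentiableWithinAt
  have hle := Complex.norm_le_of_forall_mem_frontier_norm_le Metric.isBounded_ball hdc
    (C := (m / 2)⁻¹) (fun t ht => ?_) (subset_closure (Metric.mem_ball_self hρ0))
  · have hpos : 0 < ‖φ ε 0‖ := norm_pos_iff.mpr (hε 0 (Metric.mem_ball_self hr))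
    rw [norm_inv, inv_le_inv₀ hpos (by positivity)] at hle
    linarith
  · rw [frontier_ball _ hρ0.ne'] at ht
    rw [norm_inv]
    exact inv_anti₀ (by positivity) (hε1 t ht).le

open Filter Topology in
/-- Hurwitz' theorem on a power of the upper half-plane. -/
theorem hurwitz_upperHalfPlane {σ : Type*} [Finite σ] {Φ : ℝ → (σ → ℂ) → ℂ}
    (hc : Continuous (Function.uncurry Φ))
    (hd : ∀ ε (z d : σ → ℂ), Differentiable ℂ fun t : ℂ => Φ ε (z + t • d))
    (hne : ∃ᶠ ε in 𝓝 (0 : ℝ), ∀ z : σ → ℂ, (∀ s, 0 < (z s).im) → Φ ε z ≠ 0) :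
    (∀ z : σ → ℂ, (∀ s, 0 < (z s).im) → Φ 0 z ≠ 0) ∨ ∀ z, Φ 0 z = 0 := by
  by_contra! hcon
  obtain ⟨⟨z, hz, hz0⟩, p, hp⟩ := hcon
  -- On the complex line from the zero `z` to the nonzero `p`, the one-variable theorem at `t = 0`
  -- and the identity theorem force vanishing at `t = 1`.
  have hopen : ∀ᶠ t in 𝓝 (0 : ℂ), ∀ s, 0 < ((z + t • (p - z)) s).im := by
    refine eventually_all.mpr fun s => ?_
    have : Continuous fun t : ℂ => ((z + t • (p - z)) s).im := by
      simp only [Pi.add_apply, Pi.smul_apply]; fun_prop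
    refine this.continuousAt.eventually_const_lt ?_
    simpa using hz s
  obtain ⟨r, hr, hr'⟩ := Metric.eventually_nhds_iff_ball.mp hopen
  have hev := eventually_eq_zero_of_frequently_ne_zero (φ := fun ε t => Φ ε (z + t • (p - z)))
    (hc.comp (by fun_prop : Continuous fun x : ℝ × ℂ => (x.1, z + x.2 • (p - z))))
    (fun ε => hd ε z (p - z)) hr (hne.mono fun ε h t ht => h _ (hr' t ht)) (by simpa using hz0)
  have han : AnalyticOnNhd ℂ (fun t : ℂ => Φ 0 (z + t • (p - z))) Set.univ :=
    fun t _ => (hd 0 z (p - z)).analyticAt t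
  have := han.eqOn_zero_of_preconnected_of_eventuallyEq_zero isPreconnected_univ
    (Set.mem_univ 0) hev (Set.mem_univ 1)
  exact hp (by simpa using this)

theorem continuous_mvPolynomial_eval {σ τ : Type*} [TopologicalSpace τ] (p : MvPolynomial σ ℂ)
    {f : τ → σ → ℂ} (hf : Continuous f) : Continuous fun x => eval (f x) p := by
  exact (MvPolynomial.continuous_eval p).comp hf

theorem differentiable_mvPolynomial_eval {σ : Type*} (p : MvPolynomial σ ℂ) {f : ℂ → σ → ℂ}
    (hf : ∀ s, Differentiable ℂ fun t => f t s) : Differentiable ℂ fun t => eval (f t) p := by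
  induction p using MvPolynomial.induction_on with
  | C a => simp
  | add p q hp hq => simpa using hp.fun_add hq
  | mul_X p s hp => simpa using hp.fun_mul (hf s)

/-! ### Logarithmic derivatives and the operators `1 - ε ∂_i ∂_j`. -/

/-- The logarithmic derivative of a univariate stable polynomial has nonpositive imaginary part. -/
theorem im_derivative_div_neg {p : Polynomial ℂ} (hp : ∀ z : ℂ, 0 < z.im → p.eval z ≠ 0)
    {z : ℂ} (hz : 0 < z.im) :
    (p.derivative.eval z / p.eval z).im < 0 ∨ p.derivative.eval z = 0 := by
  have hp0 : p ≠ 0 := by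
    rintro rfl
    exact hp z hz (by simp)
  rcases eq_or_ne p.roots 0 with h | h
  · right
    rw [(IsAlgClosed.splits p).eval_derivative_eq_eval_mul_sum (hp z hz), h]
    simp
  left
  rw [(IsAlgClosed.splits p).eval_derivative_div_eval_of_ne_zero (hp z hz)]
  have key : ∀ x ∈ p.roots, (1 / (z - x)).im < 0 := by
    intro x hx
    have hx' : x.im ≤ 0 := by
      by_contra! hcon
      exact hp x hcon (Polynomial.isRoot_of_mem_roots hx)
    have him : 0 < (z - x).im := by rw [Complex.sub_im]; linarith
    rw [one_div, Complex.inv_im]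
    refine div_neg_of_neg_of_pos (by linarith) (Complex.normSq_pos.mpr ?_)
    rintro h0
    rw [h0] at him
    simp at him
  have hsum : (Multiset.map (fun x => 1 / (z - x)) p.roots).sum.im =
      (Multiset.map (fun x => (1 / (z - x)).im) p.roots).sum := by
    have := map_multiset_sum Complex.imAddGroupHom (Multiset.map (fun x => 1 / (z - x)) p.roots)
    rw [Multiset.map_map] at this
    exact this
  rw [hsum]
  have := Multiset.sum_lt_sum_of_nonempty (f := fun x => (1 / (z - x)).im) (g := fun _ => (0 : ℝ))
    h key
  simpa using this

/-- Restriction of a polynomial to the line through `z` in the direction of the variable `i`. -/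
noncomputable def restrictVar {σ : Type*} [DecidableEq σ] (z : σ → ℂ) (i : σ) :
    MvPolynomial σ ℂ →ₐ[ℂ] Polynomial ℂ :=
  aeval fun k => if k = i then Polynomial.X else Polynomial.C (z k)

theorem eval_restrictVar {σ : Type*} [DecidableEq σ] (z : σ → ℂ) (i : σ) (p : MvPolynomial σ ℂ)
    (t : ℂ) : (restrictVar z i p).eval t = eval (Function.update z i t) p := by
  induction p using MvPolynomial.induction_on with
  | C a => simp [restrictVar]
  | add p q hp hq => simp [hp, hq]
  | mul_X p s hp =>
    rw [map_mul, map_mul, Polynomial.eval_mul, hp, restrictVar, aeval_X, eval_X]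
    by_cases h : s = i
    · subst h; simp
    · simp [h]

theorem derivative_restrictVar {σ : Type*} [DecidableEq σ] (z : σ → ℂ) (i : σ)
    (p : MvPolynomial σ ℂ) :
    Polynomial.derivative (restrictVar z i p) = restrictVar z i (pderiv i p) := by
  induction p using MvPolynomial.induction_on with
  | C a => simp [restrictVar]
  | add p q hp hq => simp [hp, hq]
  | mul_X p s hp =>
    rw [map_mul, Polynomial.derivative_mul, hp, Derivation.leibniz, map_add, smul_eq_mul,
      smul_eq_mul, map_mul, map_mul, pderiv_X]
    by_cases h : s = i
    · subst h; simp [restrictVar]; ring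
    · have hs : restrictVar z i (X s) = Polynomial.C (z s) := by simp [restrictVar, h]
      simp [hs, Pi.single_eq_of_ne' (Ne.symm h), mul_comm]

/-- Univariate Lieb–Sokal: if `Im (B / A) ≤ 0` on the upper half-plane and `A` is stable there, then
`A - ε B'` has no zero in the upper half-plane. -/
theorem sub_derivative_eval_ne_zero {A B : Polynomial ℂ} (hA : ∀ z : ℂ, 0 < z.im → A.eval z ≠ 0)
    (hBA : ∀ z : ℂ, 0 < z.im → (B.eval z / A.eval z).im ≤ 0) {ε : ℝ} (hε : 0 < ε)
    {z : ℂ} (hz : 0 < z.im) : A.eval z - ε * B.derivative.eval z ≠ 0 := by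
  -- `B` is itself stable or zero: a zero of `B - iηA` with `η > 0` would give `B / A = iη`, of
  -- positive imaginary part. Now let `η` decrease to `0`.
  have hB := hurwitz_upperHalfPlane (σ := Unit)
    (Φ := fun η x => B.eval (x ()) - Complex.I * η * A.eval (x ()))
    (by simp only [Function.uncurry_def]; fun_prop)
    (fun η x d => by simp only [Pi.add_apply, Pi.smul_apply, smul_eq_mul]; fun_prop)
    (by
      refine (Filter.Eventually.frequently (f := nhdsWithin (0 : ℝ) (Set.Ioi 0)) ?_).filter_mono
        nhdsWithin_le_nhds
      filter_upwards [self_mem_nhdsWithin] with η hη x hx h0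
      have h1 := hBA _ (hx ())
      rw [sub_eq_zero] at h0
      rw [h0, mul_div_cancel_right₀ _ (hA _ (hx ()))] at h1
      simp at h1
      exact absurd hη (not_lt.mpr h1))
  rcases hB with hB | hB
  · have hB' : ∀ z : ℂ, 0 < z.im → B.eval z ≠ 0 := fun z hz => by
      simpa using hB (fun _ => z) fun _ => hz
    rcases im_derivative_div_neg hB' hz with h | h
    · intro h0
      have hBz := hB' z hz
      -- At a zero, `A / B = ε B' / B` has negative imaginary part, whereas `Im (B / A) ≤ 0` makes
      -- that of `A / B` nonnegative.
      have h1 : (A.eval z / B.eval z).im = (ε * (B.derivative.eval z / B.eval z)).im := by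
        congr 1
        field_simp
        linear_combination h0
      rw [Complex.im_ofReal_mul] at h1
      have h2 := hBA z hz
      rw [← inv_div, Complex.inv_im] at h2
      have h3 : 0 ≤ (A.eval z / B.eval z).im := by
        by_contra! hcon
        refine absurd h2 (not_le.mpr (div_pos (by linarith) (Complex.normSq_pos.mpr ?_)))
        exact div_ne_zero (hA z hz) hBz
      nlinarith
    · simpa [h] using hA z hz
  · have : B = 0 := Polynomial.funext fun t => by simpa using hB fun _ => t
    simpa [this] using hA z hz

theorem update_im_pos {σ : Type*} [DecidableEq σ] {z : σ → ℂ} (hz : ∀ s, 0 < (z s).im) (i : σ)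
    {t : ℂ} (ht : 0 < t.im) (s : σ) : 0 < (Function.update z i t s).im := by
  by_cases h : s = i
  · subst h; simpa
  · simpa [h] using hz s

/-- Along the `i`-th coordinate line take `A = H` and `B = ∂_j H`: the logarithmic derivative in
direction `j` supplies `Im (B / A) ≤ 0`, and `B' = ∂_i ∂_j H`. -/
theorem IsStable.sub_pderiv_pderiv {σ : Type*} {H : MvPolynomial σ ℂ} (hH : IsStable H) (i j : σ)
    {ε : ℝ} (hε : 0 < ε) : IsStable (H - (ε : ℂ) • pderiv i (pderiv j H)) := by
  classical
  intro z hz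
  have hA : ∀ t : ℂ, 0 < t.im → (restrictVar z i H).eval t ≠ 0 := fun t ht => by
    rw [eval_restrictVar]
    exact hH _ (update_im_pos hz i ht)
  have := sub_derivative_eval_ne_zero (B := restrictVar z i (pderiv j H)) hA (fun t ht => ?_) hε
    (hz i)
  · rw [derivative_restrictVar, eval_restrictVar, eval_restrictVar, Function.update_eq_self] at this
    rwa [map_sub, smul_eval]
  · rw [eval_restrictVar, eval_restrictVar]
    set y := Function.update z i t with hy
    have hyim : ∀ s, 0 < (y s).im := update_im_pos hz i ht
    have h := im_derivative_div_neg (p := restrictVar y j H) (fun s hs => by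
      rw [eval_restrictVar]
      exact hH _ (update_im_pos hyim j hs)) (hyim j)
    rw [derivative_restrictVar, eval_restrictVar, eval_restrictVar, Function.update_eq_self] at h
    rcases h with h | h
    · exact h.le
    · simp [h]

/-! ### The Lieb–Sokal lemma through `exp(-∂_i ∂_j)`. -/

/-- The polynomial `∏_{l < k} (1 - l ε)`, which at `ε = 1 / N` equals
`N (N - 1) ⋯ (N - k + 1) / N ^ k`. -/
noncomputable def scaledFalling (k : ℕ) (ε : ℂ) : ℂ := ∏ l ∈ Finset.range k, (1 - l * ε)

@[simp]
theorem scaledFalling_zero_right (k : ℕ) : scaledFalling k 0 = 1 := by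
  simp [scaledFalling]

@[fun_prop]
theorem continuous_scaledFalling (k : ℕ) : Continuous (scaledFalling k) := by
  unfold scaledFalling
  fun_prop

theorem scaledFalling_inv {N : ℕ} (hN : N ≠ 0) (k : ℕ) :
    scaledFalling k (N : ℂ)⁻¹ = N.descFactorial k * (N : ℂ)⁻¹ ^ k := by
  have hN' : (N : ℂ) ≠ 0 := Nat.cast_ne_zero.mpr hN
  induction k with
  | zero => simp [scaledFalling]
  | succ k ih =>
    rw [scaledFalling, Finset.prod_range_succ, ← scaledFalling, ih, Nat.descFactorial_succ]
    rcases le_or_gt k N with h | h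
    · push_cast [Nat.cast_sub h]
      have h1 : (N : ℂ) * (N : ℂ)⁻¹ = 1 := mul_inv_cancel₀ hN'
      linear_combination (-(N.descFactorial k : ℂ) * (N : ℂ)⁻¹ ^ k) * h1
    · simp [Nat.descFactorial_of_lt h]

section Lieb

variable {σ : Type*}

/-- The operator `∂_i ∂_j`. -/
noncomputable def mixedDeriv (i j : σ) : Module.End ℂ (MvPolynomial σ ℂ) :=
  (pderiv (R := ℂ) i).toLinearMap * (pderiv (R := ℂ) j).toLinearMap

theorem mixedDeriv_apply (i j : σ) (H : MvPolynomial σ ℂ) :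
    mixedDeriv i j H = pderiv i (pderiv j H) := rfl

theorem mixedDeriv_pow_monomial {i j : σ} (hij : i ≠ j) (k : ℕ) (s : σ →₀ ℕ) (c : ℂ) :
    (mixedDeriv i j ^ k) (monomial s c) =
      monomial (s - Finsupp.single i k - Finsupp.single j k)
        (c * ((s i).descFactorial k * (s j).descFactorial k)) := by
  induction k with
  | zero => simp
  | succ k ih =>
    rw [pow_succ', Module.End.mul_apply, ih, mixedDeriv_apply, pderiv_monomial, pderiv_monomial]
    refine congrArg₂ (fun s c => monomial s c) ?_ ?_
    · classical
      ext x
      simp only [Finsupp.tsub_apply, Finsupp.single_apply]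
      split_ifs <;> omega
    · simp [Nat.descFactorial_succ, hij, hij.symm]
      ring

theorem mixedDeriv_pow_eq_zero {i j : σ} (hij : i ≠ j) {H : MvPolynomial σ ℂ} {k : ℕ}
    (hk : H.degreeOf i < k) : (mixedDeriv i j ^ k) H = 0 := by
  rw [H.as_sum, map_sum]
  refine Finset.sum_eq_zero fun s hs => ?_
  have : s i < k := (monomial_le_degreeOf i hs).trans_lt hk
  rw [mixedDeriv_pow_monomial hij, Nat.descFactorial_of_lt this]
  simp

theorem IsStable.one_sub_mixedDeriv_pow {H : MvPolynomial σ ℂ} (hH : IsStable H) (i j : σ)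
    {ε : ℝ} (hε : 0 < ε) (N : ℕ) : IsStable (((1 - (ε : ℂ) • mixedDeriv i j) ^ N) H) := by
  induction N with
  | zero => simpa
  | succ N ih =>
    rw [pow_succ', Module.End.mul_apply]
    exact ih.sub_pderiv_pderiv i j hε

/-- Binomial expansion, cut off at the degree in `X i`. The number of terms no longer depends on
`N`, so `1 / N` can be replaced by a continuous parameter `ε`. -/
theorem one_sub_mixedDeriv_pow_apply {i j : σ} (hij : i ≠ j) {H : MvPolynomial σ ℂ} {N : ℕ}
    (hN : N ≠ 0) (hH : H.degreeOf i ≤ N) :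
    ((1 - (N : ℂ)⁻¹ • mixedDeriv i j) ^ N) H =
      ∑ k ∈ Finset.range (H.degreeOf i + 1),
        (scaledFalling k (N : ℂ)⁻¹ * ((-1) ^ k / k.factorial)) • (mixedDeriv i j ^ k) H := by
  have hneg : -((N : ℂ)⁻¹ • mixedDeriv i j) = (-(N : ℂ)⁻¹) • mixedDeriv i j :=
    (neg_smul (N : ℂ)⁻¹ (mixedDeriv i j)).symm
  rw [sub_eq_neg_add, hneg, (Commute.one_right _).add_pow, LinearMap.sum_apply]
  refine (Finset.sum_subset (Finset.range_subset_range.mpr (by omega)) fun k _ hk => ?_).symm.trans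
    (Finset.sum_congr rfl fun k _ => ?_)
  · rw [one_pow, mul_one, smul_pow, ← nsmul_eq_mul', LinearMap.smul_apply,
      LinearMap.smul_apply, mixedDeriv_pow_eq_zero hij, smul_zero, smul_zero]
    simpa using hk
  · rw [one_pow, mul_one, smul_pow, ← nsmul_eq_mul', LinearMap.smul_apply,
      LinearMap.smul_apply, ← Nat.cast_smul_eq_nsmul ℂ, smul_smul, scaledFalling_inv hN,
      Nat.descFactorial_eq_factorial_mul_choose]
    congr 1
    have : (k.factorial : ℂ) ≠ 0 := Nat.cast_ne_zero.mpr k.factorial_ne_zero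
    push_cast
    rw [neg_pow]
    field_simp

/-- The operator `w ^ b h(v) ↦ (-1) ^ b ∂_v ^ b h(v)`, where `w = X i` and `v = X j`. -/
noncomputable def liebSokal (i j : σ) : MvPolynomial σ ℂ →ₗ[ℂ] MvPolynomial σ ℂ :=
  (basisMonomials σ ℂ).constr ℂ fun s =>
    monomial (s - Finsupp.single i (s i) - Finsupp.single j (s i))
      ((-1) ^ s i * ((s j).descFactorial (s i) : ℂ))

theorem liebSokal_monomial (i j : σ) (s : σ →₀ ℕ) (c : ℂ) :
    liebSokal i j (monomial s c) = monomial (s - Finsupp.single i (s i) - Finsupp.single j (s i))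
      (c * ((-1) ^ s i * ((s j).descFactorial (s i) : ℂ))) := by
  have : monomial s c = c • basisMonomials σ ℂ s := by
    rw [coe_basisMonomials, smul_monomial, smul_eq_mul, mul_one]
  rw [this, map_smul, liebSokal, Module.Basis.constr_basis, smul_monomial, smul_eq_mul]

/-- The sum is `exp(-∂_i ∂_j) H` at `X i = 0`. On a monomial only `k` equal to the exponent of `X i`
contributes: smaller `k` leave a factor `X i`, larger `k` differentiate to zero. -/
theorem eval_liebSokal [DecidableEq σ] {i j : σ} (hij : i ≠ j) (H : MvPolynomial σ ℂ) (z : σ → ℂ) :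
    eval z (liebSokal i j H) = ∑ k ∈ Finset.range (H.degreeOf i + 1),
      ((-1) ^ k / k.factorial) * eval (Function.update z i 0) ((mixedDeriv i j ^ k) H) := by
  suffices h : ∀ (s : σ →₀ ℕ) (c : ℂ) (K : ℕ), s i ≤ K →
      eval z (liebSokal i j (monomial s c)) = ∑ k ∈ Finset.range (K + 1),
        ((-1) ^ k / k.factorial) *
          eval (Function.update z i 0) ((mixedDeriv i j ^ k) (monomial s c)) by
    generalize hK : H.degreeOf i = K
    rw [H.as_sum]
    simp only [map_sum, Finset.mul_sum]
    rw [Finset.sum_comm]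
    exact Finset.sum_congr rfl fun s hs => h s _ K (hK ▸ monomial_le_degreeOf i hs)
  intro s c K hK
  have hupd : ∀ (t : σ →₀ ℕ) (a : ℂ), t i = 0 →
      eval (Function.update z i 0) (monomial t a) = eval z (monomial t a) := by
    intro t a ht
    rw [eval_monomial, eval_monomial]
    congr 1
    refine Finsupp.prod_congr fun x hx => ?_
    rw [Function.update_of_ne]
    rintro rfl
    exact (Finsupp.mem_support_iff.mp hx) ht
  rw [Finset.sum_eq_single (s i)]
  · rw [mixedDeriv_pow_monomial hij, hupd _ _ (by simp [hij.symm]), liebSokal_monomial,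
      eval_monomial, eval_monomial, Nat.descFactorial_self]
    have : ((s i).factorial : ℂ) ≠ 0 := Nat.cast_ne_zero.mpr (s i).factorial_ne_zero
    field_simp
  · intro k _ hk
    rw [mixedDeriv_pow_monomial hij]
    rcases lt_or_gt_of_ne hk with h | h
    · rw [eval_monomial, Finsupp.prod, Finset.prod_eq_zero (i := i), mul_zero, mul_zero]
      · simp [hij.symm]; omega
      · simp [hij.symm]; omega
    · simp [Nat.descFactorial_of_lt h]
  · intro h
    simp at h
    omega

open Filter Topology in
theorem tendsto_natCast_inv_zero : Tendsto (fun N : ℕ => ((N : ℝ))⁻¹) atTop (𝓝 0) :=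
  tendsto_inv_atTop_zero.comp tendsto_natCast_atTop_atTop

/-- The Lieb–Sokal lemma. -/
theorem IsStable.liebSokal_or_eq_zero [Finite σ] {H : MvPolynomial σ ℂ} (hH : IsStable H) {i j : σ}
    (hij : i ≠ j) : IsStable (liebSokal i j H) ∨ liebSokal i j H = 0 := by
  classical
  -- `X i` is set to `iε` because `0` is not in the open half-plane. At `ε = 1 / N` the family is
  -- `(1 - ∂_i ∂_j / N)^N H`; at `ε = 0` it is the Lieb–Sokal image.
  have key := hurwitz_upperHalfPlane (σ := σ)
    (Φ := fun ε z => ∑ k ∈ Finset.range (H.degreeOf i + 1),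
      scaledFalling k ε * ((-1) ^ k / k.factorial) *
        eval (Function.update z i (Complex.I * ε)) ((mixedDeriv i j ^ k) H)) ?_ ?_ ?_
  · simp only [Complex.ofReal_zero, scaledFalling_zero_right, one_mul, mul_zero,
      ← eval_liebSokal hij] at key
    refine key.imp (fun h z hz => h z hz) fun h => MvPolynomial.funext fun z => ?_
    rw [h, map_zero]
  · simp only [Function.uncurry_def]
    refine continuous_finsetSum _ fun k _ => Continuous.mul (by fun_prop)
      (continuous_mvPolynomial_eval _ ?_)
    exact Continuous.update (by fun_prop) i (by fun_prop)
  · intro ε z d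
    refine Differentiable.fun_sum fun k _ => Differentiable.const_mul
      (differentiable_mvPolynomial_eval _ fun s => ?_) _
    by_cases h : s = i
    · subst h; simp
    · simp only [Function.update_of_ne h, Pi.add_apply, Pi.smul_apply, smul_eq_mul]; fun_prop
  · refine tendsto_natCast_inv_zero.frequently (Filter.Eventually.frequently ?_)
    filter_upwards [Filter.eventually_ge_atTop (max 1 (H.degreeOf i))] with N hN z hz h0
    have hN1 : 1 ≤ N := (le_max_left _ _).trans hN
    have hpos : (0 : ℝ) < (N : ℝ)⁻¹ := inv_pos.mpr (Nat.cast_pos.mpr hN1)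
    refine hH.one_sub_mixedDeriv_pow i j hpos N (Function.update z i (Complex.I * (N : ℝ)⁻¹))
      (update_im_pos hz i ?_) ?_
    · rw [Complex.I_mul_im]
      simpa using Nat.pos_of_ne_zero (by omega)
    · push_cast at h0 ⊢
      rw [one_sub_mixedDeriv_pow_apply hij (by omega) ((le_max_right _ _).trans hN), map_sum]
      simpa only [smul_eval] using h0

end Lieb

/-! ### Sufficiency: contracting the symbol against `f`. -/

section Contraction

variable {n : ℕ}

/-- The contraction `A(z) w ^ β h(v) ↦ (-1) ^ |β| A(z) ∂ ^ β h(v)` over the given list of indices, in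
the variables `z_i = inl (inl i)`, `w_i = inl (inr i)`, `v_i = inr i`. -/
noncomputable def contract (l : List (Fin n)) :
    Module.End ℂ (MvPolynomial ((Fin n ⊕ Fin n) ⊕ Fin n) ℂ) :=
  (l.map fun i => liebSokal (Sum.inl (Sum.inr i)) (Sum.inr i)).prod

theorem contract_cons (i : Fin n) (l : List (Fin n))
    (H : MvPolynomial ((Fin n ⊕ Fin n) ⊕ Fin n) ℂ) :
    contract (i :: l) H = liebSokal (Sum.inl (Sum.inr i)) (Sum.inr i) (contract l H) := by
  rw [contract, List.map_cons, List.prod_cons, Module.End.mul_apply, contract]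

theorem IsStable.contract_or_eq_zero {H : MvPolynomial ((Fin n ⊕ Fin n) ⊕ Fin n) ℂ}
    (hH : IsStable H) (l : List (Fin n)) : IsStable (contract l H) ∨ contract l H = 0 := by
  induction l with
  | nil => left; simpa [contract] using hH
  | cons i l ih =>
    rw [contract_cons]
    rcases ih with h | h
    · exact h.liebSokal_or_eq_zero (by simp)
    · right; rw [h, map_zero]

theorem contract_monomial (l : List (Fin n)) (hl : l.Nodup) (s : (Fin n ⊕ Fin n) ⊕ Fin n →₀ ℕ)
    (c : ℂ) : contract l (monomial s c) =
      monomial (s - (l.map fun i => Finsupp.single (Sum.inl (Sum.inr i)) (s (Sum.inl (Sum.inr i))) +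
          Finsupp.single (Sum.inr i) (s (Sum.inl (Sum.inr i)))).sum)
        (c * (l.map fun i => (-1) ^ s (Sum.inl (Sum.inr i)) *
          ((s (Sum.inr i)).descFactorial (s (Sum.inl (Sum.inr i))) : ℂ)).prod) := by
  induction l with
  | nil => simp [contract]
  | cons i l ih =>
    rw [List.nodup_cons] at hl
    have h0 : ∀ (l : List (Fin n)), i ∉ l →
        ((l.map fun i => (Finsupp.single (Sum.inl (Sum.inr i)) (s (Sum.inl (Sum.inr i))) +
          Finsupp.single (Sum.inr i) (s (Sum.inl (Sum.inr i))) :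
            (Fin n ⊕ Fin n) ⊕ Fin n →₀ ℕ)).sum) (Sum.inl (Sum.inr i)) = 0 ∧
        ((l.map fun i => (Finsupp.single (Sum.inl (Sum.inr i)) (s (Sum.inl (Sum.inr i))) +
          Finsupp.single (Sum.inr i) (s (Sum.inl (Sum.inr i))) :
            (Fin n ⊕ Fin n) ⊕ Fin n →₀ ℕ)).sum) (Sum.inr i) = 0 := by
      intro l
      induction l with
      | nil => simp
      | cons j l ih =>
        intro h
        simp only [List.mem_cons, not_or] at h
        rw [List.map_cons, List.sum_cons, Finsupp.add_apply, (ih h.2).1,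
          Finsupp.add_apply _ _ (Sum.inr i), (ih h.2).2]
        simp [Ne.symm h.1]
    rw [contract_cons, ih hl.2, liebSokal_monomial, Finsupp.tsub_apply, Finsupp.tsub_apply,
      (h0 l hl.1).1, (h0 l hl.1).2, tsub_zero, tsub_zero, List.map_cons, List.map_cons, List.sum_cons,
      List.prod_cons, tsub_tsub, tsub_tsub, add_comm (List.sum _)]
    congr 1
    ring

theorem symbol_eq_sum (T : weylAlgebra n) :
    symbol T = (weylCoeffs T).sum fun p c => monomial (Finsupp.sumElim p.1 p.2) c := by
  rw [symbol]
  refine Finsupp.sum_congr fun p _ => ?_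
  rw [monomial_eq, Finsupp.prod_fintype _ _ (by simp), Fintype.prod_sum_type]
  simp

theorem negW_monomial (α β : Fin n →₀ ℕ) (c : ℂ) :
    negW (monomial (Finsupp.sumElim α β) c) =
      monomial (Finsupp.sumElim α β) (c * ∏ i, (-1) ^ β i) := by
  rw [negW, aeval_monomial, Finsupp.prod_fintype _ _ (by simp), Fintype.prod_sum_type,
    monomial_eq, Finsupp.prod_fintype _ _ (by simp), Fintype.prod_sum_type, C_mul]
  simp only [Finsupp.sumElim_inl, Finsupp.sumElim_inr, Sum.elim_inl, Sum.elim_inr, algebraMap_eq,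
    map_prod, map_pow, map_neg, map_one]
  have : ∀ i : Fin n, (-X (Sum.inr i) : MvPolynomial (Fin n ⊕ Fin n) ℂ) ^ β i =
    (-1) ^ β i * X (Sum.inr i) ^ β i := fun i => neg_pow _ _
  simp only [this, Finset.prod_mul_distrib]
  ring

theorem rename_mul_rename_monomial {σ τ : Type*} [Fintype σ] [Fintype τ] (s : σ →₀ ℕ)
    (t : τ →₀ ℕ) (a b : ℂ) :
    rename Sum.inl (monomial s a) * rename Sum.inr (monomial t b) =
      monomial (Finsupp.sumElim s t) (a * b) := by
  rw [monomial_eq, monomial_eq, monomial_eq, Finsupp.prod_fintype _ _ (by simp),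
    Finsupp.prod_fintype _ _ (by simp), Finsupp.prod_fintype _ _ (by simp), Fintype.prod_sum_type]
  simp only [map_mul, rename_C, map_prod, map_pow, rename_X, Finsupp.sumElim_inl,
    Finsupp.sumElim_inr]
  ring

theorem eval_contract_monomial (α β γ : Fin n →₀ ℕ) (a b : ℂ) (z w : Fin n → ℂ) :
    eval (Sum.elim (Sum.elim z w) z) (contract (List.finRange n)
      (rename Sum.inl (negW (monomial (Finsupp.sumElim α β) a)) *
        rename Sum.inr (monomial γ b))) =
      a * eval z (mulPow α (partialPow β (monomial γ b))) := by
  rw [negW_monomial, rename_mul_rename_monomial, contract_monomial _ (List.nodup_finRange n),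
    mulPow_apply, partialPow_monomial, monomial_mul, eval_monomial, eval_monomial,
    Finsupp.prod_fintype _ _ (by simp), Finsupp.prod_fintype _ _ (by simp), Fintype.prod_sum_type,
    Fintype.prod_sum_type, ← List.ofFn_eq_map, ← List.ofFn_eq_map, List.sum_ofFn, List.prod_ofFn]
  have hsq : (∏ i, (-1 : ℂ) ^ β i) * ∏ i, (-1) ^ β i = 1 := by
    rw [← Finset.prod_mul_distrib]
    exact Finset.prod_eq_one fun i _ => by rw [← mul_pow]; simp
  simp [Finsupp.single_apply, pow_add, Finset.prod_mul_distrib]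
  linear_combination (a * b * (∏ i, ((γ i).descFactorial (β i) : ℂ)) * (∏ i, z i ^ α i) *
    ∏ i, z i ^ (γ i - β i)) * hsq

/-- The signs of `F(z,-w)` cancel those of `w ↦ -∂_v`. The point `w` is arbitrary because
contraction removes these variables. -/
theorem eval_contract_symbol (T : weylAlgebra n) (f : MvPolynomial (Fin n) ℂ) (z w : Fin n → ℂ) :
    eval (Sum.elim (Sum.elim z w) z) (contract (List.finRange n)
      (rename Sum.inl (negW (symbol T)) * rename Sum.inr f)) =
      eval z ((T : Module.End ℂ (MvPolynomial (Fin n) ℂ)) f) := by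
  induction f using MvPolynomial.induction_on' with
  | monomial γ b =>
    rw [diffOp_weylCoeffs, diffOp, symbol_eq_sum, Finsupp.sum, Finsupp.sum, negW, map_sum, map_sum,
      Finset.sum_mul, map_sum, map_sum, LinearMap.sum_apply, map_sum]
    refine Finset.sum_congr rfl fun p _ => ?_
    rw [LinearMap.smul_apply, smul_eval, Module.End.mul_apply]
    exact eval_contract_monomial _ _ _ _ _ _ _
  | add f g hf hg => simp only [map_add, mul_add, hf, hg]

theorem IsStable.rename {σ τ : Type*} {f : MvPolynomial σ ℂ} (hf : IsStable f) (e : σ → τ) :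
    IsStable (rename e f) := fun z hz => by
  rw [eval_rename]
  exact hf _ fun s => hz _

theorem IsStable.mul {σ : Type*} {f g : MvPolynomial σ ℂ} (hf : IsStable f) (hg : IsStable g) :
    IsStable (f * g) := fun z hz => by
  rw [map_mul]
  exact mul_ne_zero (hf z hz) (hg z hz)

/-- An operator whose symbol `F(z, -w)` is stable preserves stability. -/
theorem isStable_apply_or_eq_zero_of_symbol {T : weylAlgebra n}
    (hT : IsStable (negW (symbol T))) {f : MvPolynomial (Fin n) ℂ} (hf : IsStable f) :
    IsStable ((T : Module.End ℂ (MvPolynomial (Fin n) ℂ)) f) ∨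
      (T : Module.End ℂ (MvPolynomial (Fin n) ℂ)) f = 0 := by
  refine (((hT.rename Sum.inl).mul (hf.rename Sum.inr)).contract_or_eq_zero (List.finRange n)).imp
    (fun h z hz => ?_) fun h => MvPolynomial.funext fun z => ?_
  · rw [← eval_contract_symbol T f z z]
    refine h _ ?_
    rintro ((i | i) | i) <;> exact hz i
  · rw [← eval_contract_symbol T f z z, h, map_zero, map_zero]

end Contraction

/-! ### Differential operators with small range. -/

section Range

variable {n : ℕ}

/-- A differential operator lowers the order of vanishing along a hyperplane `z_i = c` by a bounded
amount. -/
theorem exists_pow_dvd_apply (i : Fin n) {T : Module.End ℂ (MvPolynomial (Fin n) ℂ)}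
    (hT : T ∈ weylAlgebra n) : ∃ K, ∀ (c : ℂ) (m : ℕ) (g : MvPolynomial (Fin n) ℂ),
      (X i - C c) ^ m ∣ T ((X i - C c) ^ (m + K) * g) := by
  change T ∈ Algebra.adjoin ℂ _ at hT
  induction hT using Algebra.adjoin_induction with
  | mem S hS =>
    rcases hS with ⟨j, rfl⟩ | ⟨j, rfl⟩
    · refine ⟨0, fun c m g => ?_⟩
      rw [mulVar, LinearMap.mulLeft_apply, add_zero]
      exact Dvd.intro _ (mul_left_comm _ _ _)
    · refine ⟨1, fun c m g => ?_⟩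
      change _ ∣ pderiv j _
      rw [Derivation.leibniz, Derivation.leibniz_pow, smul_eq_mul, smul_eq_mul, Nat.add_sub_cancel]
      refine dvd_add (Dvd.dvd.mul_right (pow_dvd_pow _ (Nat.le_succ m)) _)
        (Dvd.dvd.mul_left (dvd_smul_of_dvd _ (Dvd.intro _ rfl)) _)
  | algebraMap r =>
    refine ⟨0, fun c m g => ?_⟩
    rw [Algebra.algebraMap_eq_smul_one, LinearMap.smul_apply, Module.End.one_apply, add_zero,
      smul_eq_C_mul]
    exact Dvd.intro _ (mul_left_comm _ _ _)
  | add S T _ _ hS hT =>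
    obtain ⟨K, hK⟩ := hS
    obtain ⟨L, hL⟩ := hT
    refine ⟨K + L, fun c m g => ?_⟩
    rw [LinearMap.add_apply]
    refine dvd_add ?_ ?_
    · rw [← add_assoc, pow_add _ (m + K), mul_assoc]
      exact hK _ _ _
    · rw [add_comm K, ← add_assoc, pow_add _ (m + L), mul_assoc]
      exact hL _ _ _
  | mul S T _ _ hS hT =>
    obtain ⟨K, hK⟩ := hS
    obtain ⟨L, hL⟩ := hT
    refine ⟨K + L, fun c m g => ?_⟩
    obtain ⟨h, hh⟩ := hL c (m + K) g
    rw [Module.End.mul_apply, ← add_assoc, hh]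
    exact hK _ _ _

theorem eq_zero_of_X_sub_C_pow_dvd {σ : Type*} {i : σ} {c : ℂ} {m : ℕ} {Q : MvPolynomial σ ℂ}
    (hm : Q.degreeOf i < m) (h : (X i - C c) ^ m ∣ Q) : Q = 0 := by
  classical
  by_contra hQ
  obtain ⟨R, rfl⟩ := h
  have hdeg : 1 ≤ degreeOf i (X i - C c : MvPolynomial σ ℂ) := by
    have := degreeOf_add_le i (X i - C c : MvPolynomial σ ℂ) (C c)
    rwa [sub_add_cancel, degreeOf_X_self, degreeOf_C, Nat.max_zero] at this
  have hXc : (X i - C c : MvPolynomial σ ℂ) ≠ 0 := by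
    intro h0
    rw [h0, degreeOf_zero] at hdeg
    omega
  rw [degreeOf_mul_eq (pow_ne_zero _ hXc) (right_ne_zero_of_mul hQ), degreeOf_pow_eq _ _ _ hXc]
    at hm
  have := Nat.mul_le_mul_left m hdeg
  omega

/-- A differential operator in at least one variable whose range is contained in a line is zero. -/
theorem eq_zero_of_range_le_span (i : Fin n) {T : Module.End ℂ (MvPolynomial (Fin n) ℂ)}
    (hT : T ∈ weylAlgebra n) {Q : MvPolynomial (Fin n) ℂ} (h : ∀ g, ∃ c : ℂ, T g = c • Q) :
    T = 0 := by
  obtain ⟨K, hK⟩ := exists_pow_dvd_apply i hT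
  set m := Q.degreeOf i + 1
  -- The value is a multiple of `Q`, of degree less than `m` in `X i`, yet divisible by `(X i -
  -- c)^m`.
  have hkill : ∀ (c : ℂ) (g : MvPolynomial (Fin n) ℂ), T ((X i - C c) ^ (m + K) * g) = 0 := by
    intro c g
    refine eq_zero_of_X_sub_C_pow_dvd (i := i) (c := c) (m := m) ?_ (hK c m g)
    obtain ⟨r, hr⟩ := h ((X i - C c) ^ (m + K) * g)
    rw [hr, smul_eq_C_mul]
    exact Nat.lt_succ_of_le (degreeOf_C_mul_le _ _ _)
  -- The ideals killed for `c = 1` and `c = 0` together span the whole ring.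
  have hcop : IsCoprime ((X i - C 1 : MvPolynomial (Fin n) ℂ) ^ (m + K))
      ((X i - C 0 : MvPolynomial (Fin n) ℂ) ^ (m + K)) :=
    IsCoprime.pow ⟨-1, 1, by rw [C_1, C_0]; ring⟩
  obtain ⟨a, b, hab⟩ := hcop
  refine LinearMap.ext fun g => ?_
  have hg : g = (X i - C 1) ^ (m + K) * (a * g) + (X i - C 0) ^ (m + K) * (b * g) := by
    linear_combination (-g) * hab
  rw [hg, map_add, hkill, hkill, add_zero, LinearMap.zero_apply]

/-- A differential operator in at least one variable all of whose values are stable or zero is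
zero. -/
theorem eq_zero_of_forall_isStable_or_eq_zero (i : Fin n)
    {T : Module.End ℂ (MvPolynomial (Fin n) ℂ)} (hT : T ∈ weylAlgebra n)
    (h : ∀ g, IsStable (T g) ∨ T g = 0) : T = 0 := by
  by_contra hne
  obtain ⟨g₀, hg₀⟩ : ∃ g, T g ≠ 0 := by
    by_contra! hcon
    exact hne (LinearMap.ext hcon)
  have hI : ∀ _ : Fin n, 0 < Complex.I.im := by simp
  have hz := (h g₀).resolve_right hg₀ (fun _ => Complex.I) hI
  refine hne (eq_zero_of_range_le_span i hT (Q := T g₀) fun g =>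
    ⟨eval (fun _ => Complex.I) (T g) / eval (fun _ => Complex.I) (T g₀), ?_⟩)
  -- This combination is chosen so that its image vanishes at `(i, …, i)`; not being stable, the
  -- image is zero.
  have hsub := (h (g - (eval (fun _ => Complex.I) (T g) / eval (fun _ => Complex.I) (T g₀)) •
    g₀)).resolve_left fun hst => hst (fun _ => Complex.I) hI (by
      rw [map_sub, map_sub, map_smul, smul_eval, div_mul_cancel₀ _ hz, sub_self])
  rw [map_sub, map_smul, sub_eq_zero] at hsub
  exact hsub

end Range

/-! ### The test polynomials `∏ (1 - b_j X_j)^N` and their perturbations. -/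

section AffineSubst

variable {n : ℕ}

/-- The substitution `X_j ↦ 1 - b_j X_j`. -/
noncomputable def affineSubst (b : Fin n → ℂ) :
    MvPolynomial (Fin n) ℂ →ₐ[ℂ] MvPolynomial (Fin n) ℂ :=
  aeval fun j => 1 - C (b j) * X j

theorem eval_affineSubst_monomial (b z : Fin n → ℂ) (s : Fin n →₀ ℕ) (c : ℂ) :
    eval z (affineSubst b (monomial s c)) = c * ∏ j, (1 - b j * z j) ^ s j := by
  rw [affineSubst, aeval_monomial, Finsupp.prod_fintype _ _ (by simp)]
  simp

theorem partialDeriv_affineSubst (b : Fin n → ℂ) (i : Fin n) (g : MvPolynomial (Fin n) ℂ) :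
    partialDeriv i (affineSubst b g) = (-b i) • affineSubst b (partialDeriv i g) := by
  change pderiv i _ = _ • affineSubst b (pderiv i g)
  induction g using MvPolynomial.induction_on with
  | C a => simp [affineSubst]
  | add p q hp hq => simp only [map_add, hp, hq, smul_add]
  | mul_X p s hp =>
    rw [map_mul, Derivation.leibniz, Derivation.leibniz, hp, map_add, smul_add]
    have hX : pderiv i (affineSubst b (X s)) = (-b i) • affineSubst b (pderiv i (X s)) := by
      rw [affineSubst, aeval_X, map_sub, pderiv_one, pderiv_C_mul, pderiv_X]
      by_cases h : s = i
      · subst h; simp [smul_eq_C_mul]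
      · simp [Pi.single_eq_of_ne' (Ne.symm h)]
    rw [hX]
    simp only [smul_eq_mul, map_mul, mul_smul_comm]

theorem partialDeriv_pow_affineSubst (b : Fin n → ℂ) (i : Fin n) (k : ℕ)
    (g : MvPolynomial (Fin n) ℂ) : (partialDeriv i ^ k) (affineSubst b g) =
      (-b i) ^ k • affineSubst b ((partialDeriv i ^ k) g) := by
  induction k with
  | zero => simp
  | succ k ih =>
    rw [pow_succ', Module.End.mul_apply, ih, map_smul, partialDeriv_affineSubst, smul_smul,
      Module.End.mul_apply, pow_succ]

theorem partialPow_affineSubst (b : Fin n → ℂ) (β : Fin n →₀ ℕ) (g : MvPolynomial (Fin n) ℂ) :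
    partialPow β (affineSubst b g) = (∏ i, (-b i) ^ β i) • affineSubst b (partialPow β g) := by
  have h : ∀ l : List (Fin n), (l.map fun i => partialDeriv i ^ β i).prod (affineSubst b g) =
      (l.map fun i => (-b i) ^ β i).prod •
        affineSubst b ((l.map fun i => partialDeriv i ^ β i).prod g) := by
    intro l
    induction l with
    | nil => simp
    | cons i l ih =>
      rw [List.map_cons, List.prod_cons, Module.End.mul_apply, ih, map_smul,
        partialDeriv_pow_affineSubst, smul_smul, List.map_cons, List.prod_cons,
        Module.End.mul_apply, mul_comm]
  rw [partialPow, h, ← List.ofFn_eq_map, List.prod_ofFn]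

/-- The polynomial `∏_j (1 - b_j X_j) ^ N`. -/
noncomputable def powProduct (b : Fin n → ℂ) (N : ℕ) : MvPolynomial (Fin n) ℂ :=
  affineSubst b (monomial (Finsupp.equivFunOnFinite.symm fun _ => N) 1)

theorem eval_powProduct (b z : Fin n → ℂ) (N : ℕ) :
    eval z (powProduct b N) = ∏ j, (1 - b j * z j) ^ N := by
  simp [powProduct, eval_affineSubst_monomial]

theorem eval_mulPow_partialPow_powProduct (b z : Fin n → ℂ) (N : ℕ) (α β : Fin n →₀ ℕ) :
    eval z (mulPow α (partialPow β (powProduct b N))) =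
      (∏ j, z j ^ α j) *
        ∏ j, (-b j) ^ β j * N.descFactorial (β j) * (1 - b j * z j) ^ (N - β j) := by
  rw [mulPow_apply, powProduct, partialPow_affineSubst, partialPow_monomial, map_mul, smul_eval,
    eval_affineSubst_monomial, eval_monomial, Finsupp.prod_fintype _ _ (by simp)]
  simp only [Finset.prod_mul_distrib, Finsupp.tsub_apply, Finsupp.coe_equivFunOnFinite_symm]
  ring

/-- The zero `1 / b` lies in the open lower half-plane, so `|1 - bz|` is bounded below for `z` in
the upper one; for large `z` it grows like `|b| |z|`. -/
theorem exists_max_one_norm_le {b : ℂ} (hb : 0 < b.im) :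
    ∃ K : ℝ, ∀ z : ℂ, 0 < z.im → max 1 ‖z‖ ≤ K * ‖1 - b * z‖ := by
  have hb0 : b ≠ 0 := by rintro rfl; simp at hb
  have hbn : 0 < ‖b‖ := norm_pos_iff.mpr hb0
  set m := b.im / ‖b‖ with hm
  have hm0 : 0 < m := div_pos hb hbn
  have h1 : ∀ z : ℂ, 0 < z.im → m ≤ ‖1 - b * z‖ := by
    intro z hz
    have : 1 - b * z = b * (b⁻¹ - z) := by field_simp
    rw [this, norm_mul]
    have h2 : b.im / ‖b‖ ^ 2 ≤ ‖b⁻¹ - z‖ := by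
      refine le_trans ?_ (Complex.abs_im_le_norm _)
      rw [Complex.sub_im, Complex.inv_im, Complex.normSq_eq_norm_sq, neg_div]
      refine le_trans ?_ (neg_le_abs _)
      linarith
    calc m = ‖b‖ * (b.im / ‖b‖ ^ 2) := by rw [hm]; field_simp
      _ ≤ _ := by gcongr
  refine ⟨max (1 / m) ((1 + 1 / m) / ‖b‖), fun z hz => max_le ?_ ?_⟩
  · calc (1 : ℝ) = 1 / m * m := by field_simp
      _ ≤ _ := mul_le_mul (le_max_left _ _) (h1 z hz) hm0.le (by positivity)
  · have h2 : ‖b‖ * ‖z‖ ≤ 1 + ‖1 - b * z‖ := by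
      rw [← norm_mul]
      calc ‖b * z‖ = ‖1 - (1 - b * z)‖ := by congr 1; ring
        _ ≤ _ := by simpa using norm_sub_le (1 : ℂ) (1 - b * z)
    have h3 : (1 : ℝ) ≤ 1 / m * ‖1 - b * z‖ := by
      rw [one_div_mul_eq_div, le_div_iff₀ hm0, one_mul]; exact h1 z hz
    calc ‖z‖ = ‖b‖ * ‖z‖ / ‖b‖ := by field_simp
      _ ≤ (1 / m * ‖1 - b * z‖ + ‖1 - b * z‖) / ‖b‖ := by gcongr; linarith
      _ = (1 + 1 / m) / ‖b‖ * ‖1 - b * z‖ := by ring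
      _ ≤ _ := by gcongr; exact le_max_right _ _

theorem isStable_powProduct {b : Fin n → ℂ} (hb : ∀ j, 0 < (b j).im) (N : ℕ) :
    IsStable (powProduct b N) := by
  intro z hz
  rw [eval_powProduct]
  refine Finset.prod_ne_zero_iff.mpr fun j _ => pow_ne_zero _ fun h0 => ?_
  obtain ⟨K, hK⟩ := exists_max_one_norm_le (hb j)
  have := (le_max_left _ _).trans (hK (z j) (hz j))
  rw [h0, norm_zero, mul_zero] at this
  linarith

theorem exists_norm_eval_le_mul_powProduct {b : Fin n → ℂ} (hb : ∀ j, 0 < (b j).im) {N : ℕ}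
    {g : MvPolynomial (Fin n) ℂ} (hg : ∀ j, g.degreeOf j ≤ N) :
    ∃ M : ℝ, ∀ z : Fin n → ℂ, (∀ j, 0 < (z j).im) →
      ‖eval z g‖ ≤ M * ‖eval z (powProduct b N)‖ := by
  choose K hK using fun j => exists_max_one_norm_le (hb j)
  refine ⟨∑ s ∈ g.support, ‖coeff s g‖ * ∏ j, K j ^ N, fun z hz => ?_⟩
  rw [eval_eq', Finset.sum_mul]
  refine (norm_sum_le _ _).trans (Finset.sum_le_sum fun s hs => ?_)
  rw [norm_mul, mul_assoc, eval_powProduct, norm_prod, norm_prod, ← Finset.prod_mul_distrib]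
  refine mul_le_mul_of_nonneg_left (Finset.prod_le_prod (fun _ _ => norm_nonneg _) fun j _ => ?_)
    (norm_nonneg _)
  rw [norm_pow, norm_pow, ← mul_pow]
  calc ‖z j‖ ^ s j ≤ max 1 ‖z j‖ ^ s j := by gcongr; exact le_max_right _ _
    _ ≤ max 1 ‖z j‖ ^ N :=
      pow_le_pow_right₀ (le_max_left _ _) ((monomial_le_degreeOf j hs).trans (hg j))
    _ ≤ _ := by gcongr; exact hK j (z j) (hz j)

/-- Since `|g| ≤ M |P|` on the half-planes for the product `P`, the choice `ε = 1 / (|M| + 1)` keeps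
`|εg| < |P|`. -/
theorem exists_isStable_powProduct_add {b : Fin n → ℂ} (hb : ∀ j, 0 < (b j).im) {N : ℕ}
    {g : MvPolynomial (Fin n) ℂ} (hg : ∀ j, g.degreeOf j ≤ N) :
    ∃ ε : ℂ, ε ≠ 0 ∧ IsStable (powProduct b N + ε • g) := by
  obtain ⟨M, hM⟩ := exists_norm_eval_le_mul_powProduct hb hg
  have hM0 : 0 < |M| + 1 := by positivity
  refine ⟨((|M| + 1 : ℝ) : ℂ)⁻¹, inv_ne_zero (Complex.ofReal_ne_zero.mpr hM0.ne'),
    fun z hz h0 => ?_⟩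
  have hpos : 0 < ‖eval z (powProduct b N)‖ := norm_pos_iff.mpr (isStable_powProduct hb N z hz)
  rw [map_add, smul_eval, add_eq_zero_iff_eq_neg] at h0
  have h1 : ‖eval z (powProduct b N)‖ = (|M| + 1)⁻¹ * ‖eval z g‖ := by
    rw [h0, norm_neg, norm_mul, norm_inv, Complex.norm_real, Real.norm_of_nonneg hM0.le]
  have h2 := hM z hz
  have h3 : ‖eval z g‖ = (|M| + 1) * ‖eval z (powProduct b N)‖ := by
    rw [h1]; field_simp
  nlinarith [le_abs_self M]

/-- If a stability preserver annihilates some `∏ (1 - b_j z_j) ^ N`, then it maps every polynomial of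
degree at most `N` in each variable to a stable polynomial or to zero. -/
theorem isStable_apply_or_eq_zero_of_apply_powProduct
    {T : Module.End ℂ (MvPolynomial (Fin n) ℂ)}
    (hT : ∀ f, IsStable f → IsStable (T f) ∨ T f = 0) {b : Fin n → ℂ} (hb : ∀ j, 0 < (b j).im)
    {N : ℕ} (h0 : T (powProduct b N) = 0) {g : MvPolynomial (Fin n) ℂ}
    (hg : ∀ j, g.degreeOf j ≤ N) : IsStable (T g) ∨ T g = 0 := by
  obtain ⟨ε, hε, hst⟩ := exists_isStable_powProduct_add hb hg
  have := hT _ hst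
  rw [map_add, map_smul, h0, zero_add] at this
  refine this.imp (fun h z hz hz0 => h z hz ?_) fun h => (smul_eq_zero.mp h).resolve_left hε
  rw [smul_eval, hz0, mul_zero]

end AffineSubst

/-! ### Necessity: recovering the symbol as a limit. -/

section Symbol

variable {n : ℕ}

theorem eval_negW_symbol (T : weylAlgebra n) (x : Fin n ⊕ Fin n → ℂ) :
    eval x (negW (symbol T)) = ∑ p ∈ (weylCoeffs T).support, weylCoeffs T p *
      ((∏ i, x (Sum.inl i) ^ p.1 i) * ∏ i, (-x (Sum.inr i)) ^ p.2 i) := by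
  rw [symbol, Finsupp.sum, negW, map_sum, map_sum]
  simp

theorem eq_zero_of_negW_symbol_eq_zero {T : weylAlgebra n} (h : negW (symbol T) = 0) : T = 0 := by
  classical
  have hcoeff : weylCoeffs T = 0 := by
    ext p
    have h1 := congrArg (coeff (Finsupp.sumElim p.1 p.2)) h
    have hinj : ∀ q : (Fin n →₀ ℕ) × (Fin n →₀ ℕ),
        Finsupp.sumElim q.1 q.2 = Finsupp.sumElim p.1 p.2 → q = p := fun q hq =>
      Prod.ext (Finsupp.ext fun i => by simpa using DFunLike.congr_fun hq (Sum.inl i))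
        (Finsupp.ext fun i => by simpa using DFunLike.congr_fun hq (Sum.inr i))
    have hneg : negW (symbol T) = ∑ q ∈ (weylCoeffs T).support,
        monomial (Finsupp.sumElim q.1 q.2) (weylCoeffs T q * ∏ i, (-1) ^ q.2 i) := by
      rw [symbol_eq_sum, Finsupp.sum, negW, map_sum]
      exact Finset.sum_congr rfl fun q _ => negW_monomial _ _ _
    rw [hneg, coeff_sum, Finset.sum_eq_single p] at h1
    · rw [coeff_monomial, if_pos rfl, coeff_zero] at h1
      exact (mul_eq_zero.mp h1).resolve_right
        (Finset.prod_ne_zero_iff.mpr fun i _ => pow_ne_zero _ (by norm_num))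
    · intro q _ hq
      rw [coeff_monomial, if_neg fun hq' => hq (hinj q hq')]
    · intro hp
      rw [Finsupp.notMem_support_iff.mp hp, zero_mul, monomial_zero, coeff_zero]
  refine Subtype.ext ?_
  rw [diffOp_weylCoeffs, hcoeff]
  exact Finsupp.sum_zero_index

/-- The deformation of `F(z, -w)` that at `ε = 1 / N` is, up to powers of the factors
`1 - w_j z_j / N`, the value at `z` of `T (∏ (1 - w_j z_j / N) ^ N)`. -/
noncomputable def symbolDeformation (T : weylAlgebra n) (B : ℕ) (ε : ℝ) (x : Fin n ⊕ Fin n → ℂ) :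
    ℂ :=
  ∑ p ∈ (weylCoeffs T).support, weylCoeffs T p * ((∏ i, x (Sum.inl i) ^ p.1 i) *
    ∏ i, (-x (Sum.inr i)) ^ p.2 i * scaledFalling (p.2 i) ε *
      (1 - ε * x (Sum.inr i) * x (Sum.inl i)) ^ (B - p.2 i))

theorem symbolDeformation_zero (T : weylAlgebra n) (B : ℕ) (x : Fin n ⊕ Fin n → ℂ) :
    symbolDeformation T B 0 x = eval x (negW (symbol T)) := by
  simp [symbolDeformation, eval_negW_symbol]

theorem continuous_symbolDeformation (T : weylAlgebra n) (B : ℕ) :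
    Continuous (Function.uncurry (symbolDeformation T B)) := by
  simp only [Function.uncurry_def, symbolDeformation]
  fun_prop

theorem differentiable_symbolDeformation (T : weylAlgebra n) (B : ℕ) (ε : ℝ)
    (x d : Fin n ⊕ Fin n → ℂ) :
    Differentiable ℂ fun t : ℂ => symbolDeformation T B ε (x + t • d) := by
  simp only [symbolDeformation, Pi.add_apply, Pi.smul_apply, smul_eq_mul]
  fun_prop

/-- Each `∂_i^{β_i}` lowers the exponent `N` by `β_i ≤ B`, so the power `N - B` of every factor
comes out of all terms; what remains is polynomial in `1 / N`. -/
theorem eval_apply_powProduct (T : weylAlgebra n) {B : ℕ}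
    (hB : ∀ p ∈ (weylCoeffs T).support, ∀ i, p.2 i ≤ B) {N : ℕ} (hN : N ≠ 0) (hBN : B ≤ N)
    (x : Fin n ⊕ Fin n → ℂ) :
    eval (fun i => x (Sum.inl i)) ((T : Module.End ℂ (MvPolynomial (Fin n) ℂ))
      (powProduct (fun i => (N : ℂ)⁻¹ * x (Sum.inr i)) N)) =
    symbolDeformation T B (N : ℝ)⁻¹ x *
      ∏ i, (1 - (N : ℂ)⁻¹ * x (Sum.inr i) * x (Sum.inl i)) ^ (N - B) := by
  rw [diffOp_weylCoeffs, diffOp, Finsupp.sum, LinearMap.sum_apply, map_sum, symbolDeformation,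
    Finset.sum_mul]
  refine Finset.sum_congr rfl fun p hp => ?_
  rw [LinearMap.smul_apply, smul_eval, Module.End.mul_apply, eval_mulPow_partialPow_powProduct,
    mul_assoc, mul_assoc]
  congr 2
  rw [← Finset.prod_mul_distrib]
  refine Finset.prod_congr rfl fun i _ => ?_
  have hpow : N - p.2 i = (B - p.2 i) + (N - B) := by
    have := hB p hp i
    omega
  rw [hpow, pow_add, ← mul_neg, mul_pow]
  push_cast
  rw [scaledFalling_inv hN]
  ring

/-- The symbol `F(z, -w)` of a nonzero operator that preserves stability is stable. -/
theorem isStable_negW_symbol {T : weylAlgebra n} (hT0 : T ≠ 0)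
    (hT : ∀ f, IsStable f → IsStable ((T : Module.End ℂ (MvPolynomial (Fin n) ℂ)) f) ∨
      (T : Module.End ℂ (MvPolynomial (Fin n) ℂ)) f = 0) : IsStable (negW (symbol T)) := by
  set B := (weylCoeffs T).support.sup fun p => p.2.degree
  have hB : ∀ p ∈ (weylCoeffs T).support, ∀ i, p.2 i ≤ B := fun p hp i =>
    (Finsupp.le_degree i p.2).trans (Finset.le_sup (f := fun p => p.2.degree) hp)
  by_cases hfreq : ∃ᶠ N : ℕ in Filter.atTop, ∀ x : Fin n ⊕ Fin n → ℂ, (∀ s, 0 < (x s).im) →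
      symbolDeformation T B (N : ℝ)⁻¹ x ≠ 0
  · rcases hurwitz_upperHalfPlane (continuous_symbolDeformation T B)
      (differentiable_symbolDeformation T B) (tendsto_natCast_inv_zero.frequently hfreq) with h | h
    · exact fun x hx => symbolDeformation_zero T B x ▸ h x hx
    · refine absurd (eq_zero_of_negW_symbol_eq_zero (MvPolynomial.funext fun x => ?_)) hT0
      rw [← symbolDeformation_zero T B, h, map_zero]
  exfalso
  -- A zero of the deformation at `1 / N` makes the image of a stable product vanish in the
  -- half-planes, so that image is not stable and must be zero.
  have hkill : ∀ d : ℕ, ∃ N ≥ d, ∃ b : Fin n → ℂ, (∀ j, 0 < (b j).im) ∧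
      (T : Module.End ℂ (MvPolynomial (Fin n) ℂ)) (powProduct b N) = 0 := by
    intro d
    obtain ⟨N, hN, hNd⟩ := ((Filter.not_frequently.mp hfreq).and
      (Filter.eventually_ge_atTop (max d (max 1 B)))).exists
    simp only [max_le_iff] at hNd
    push Not at hN
    obtain ⟨x, hx, hx0⟩ := hN
    have hN0 : N ≠ 0 := by omega
    have hb : ∀ j, 0 < ((N : ℂ)⁻¹ * x (Sum.inr j)).im := fun j => by
      rw [← Complex.ofReal_natCast, ← Complex.ofReal_inv, Complex.im_ofReal_mul]
      have : (0 : ℝ) < N := Nat.cast_pos.mpr hNd.2.1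
      exact mul_pos (inv_pos.mpr this) (hx _)
    refine ⟨N, hNd.1, _, hb, (hT _ (isStable_powProduct hb N)).resolve_left fun h => ?_⟩
    refine h (fun i => x (Sum.inl i)) (fun i => hx _) ?_
    rw [eval_apply_powProduct T hB hN0 hNd.2.2, hx0, zero_mul]
  rcases n with _ | n
  -- Without variables the range argument is unavailable, but the product is the constant `1`, which
  -- spans everything.
  · obtain ⟨N, -, b, -, h0⟩ := hkill 0
    refine hT0 (Subtype.ext (LinearMap.ext fun g => ?_))
    have hg : g = coeff 0 g • powProduct b N :=
      MvPolynomial.funext fun z => by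
        rw [smul_eval, eval_powProduct, Finset.univ_eq_empty, Finset.prod_empty, mul_one]
        conv_lhs => rw [eq_C_of_isEmpty g, eval_C]
    rw [hg, map_smul, h0, smul_zero]
    rfl
  · refine hT0 (Subtype.ext (eq_zero_of_forall_isStable_or_eq_zero 0 T.2 fun g => ?_))
    obtain ⟨N, hN, b, hb, h0⟩ := hkill g.totalDegree
    exact isStable_apply_or_eq_zero_of_apply_powProduct hT hb h0 fun j =>
      (degreeOf_le_totalDegree g j).trans hN

end Symbol

theorem theorem1p2 (n : ℕ) (T : weylAlgebra n) :
    T ∈ stabilityPreservers n ↔ negW (symbol T) ∈ stablePolynomials (Fin n ⊕ Fin n) := by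
  refine ⟨fun h => isStable_negW_symbol h.1 fun f hf => h.2 f hf, fun h => ⟨?_, fun f hf =>
    isStable_apply_or_eq_zero_of_symbol h hf⟩⟩
  -- The zero operator is excluded because its symbol is zero, hence not stable.
  rintro rfl
  refine h (fun _ => Complex.I) (by simp) ?_
  have h0 : weylCoeffs (0 : weylAlgebra n) = 0 := by
    refine diffOpLinear_injective n ?_
    rw [diffOpLinear_apply, ← diffOp_weylCoeffs, map_zero]
    rfl
  rw [eval_negW_symbol, h0]
  simp
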